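/- Let FI be the category whose objects are finite sets and whose morphisms are injections. Let $k$ be a field of characteristic $0$, and let $V$ be an FI-module over $k$, that is, a functor from FI to the category of $k$-vector spaces. Write $V_n := V(\{1,\dots,n\})$; functoriality makes $V_n$ a representation of the symmetric group $S_n$. Assume that $V$ is finitely generated: there is a finite set $S\subset\coprod_{n\ge 0} V_n$ such that no proper sub-FI-module of $V$ contains $S$. For $i\ge 1$ and $\sigma\in S_n$, let $X_i(\sigma)$ be the number of $i$-cycles in the cycle decomposition of $\sigma$ (so $X_1(\sigma)$ is the number of fixed points). Then every $V_n$ is finite-dimensional, and the sequence of characters $\chi_{V_n}(\sigma)=\operatorname{Trace}(\sigma\mid V_n)$ is eventually polynomial: there exist $N\ge 0$, $r>0$ and a polynomial $P\in\mathbb{Q}[X_1,\dots,X_r]$ such that $$\chi_{V_n}(\sigma)=P\bigl(X_1(\sigma),\dots,X_r(\sigma)\bigr)\qquad\text{for all } n\ge N \text{ and all } \sigma\in S_n .$$ In particular, $\dim_k V_n$ is a polynomial in $n$ for $n\ge N$: there is $Q\in\mathbb{Q}[T]$ with $\dim_k V_n=Q(n)$ for all $n\ge N$. -/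

import Mathlib

open CategoryTheory

universe v u

/-- Objects of the category `FI`: finite sets. -/
structure FI where
  /-- the underlying set -/
  carrier : Type
  [finite : Finite carrier]

namespace FI

/-- The category `FI`: morphisms are the injections, with the usual composition of maps
(`f ≫ g` is `f` followed by `g`). -/
instance : Category FI where
  Hom X Y := X.carrier ↪ Y.carrier
  id X := Function.Embedding.refl X.carrier
  comp f g := Function.Embedding.trans f g

/-- The standard set with `n` elements. -/
def std (n : ℕ) : FI := ⟨Fin n⟩

/-- A permutation of the standard set with `n` elements, as an endomorphism in `FI`. -/
def ofPerm {n : ℕ} (σ : Equiv.Perm (Fin n)) : std n ⟶ std n := σ.toEmbedding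

end FI

/-- An FI-module over `k`: a functor from `FI` to the category of `k`-modules. -/
abbrev FIModule (k : Type u) [Ring k] := FI ⥤ ModuleCat.{v} k

namespace FIModule

variable {k : Type u}

/-- A sub-FI-module: a submodule of every `V(X)`, compatible with all induced maps. -/
structure Sub [Ring k] (V : FIModule.{v} k) where
  /-- the submodule of `V(X)` -/
  submodule : (X : FI) → Submodule k (V.obj X)
  map_mem : ∀ {X Y : FI} (f : X ⟶ Y) (x : V.obj X),
    x ∈ submodule X → (V.map f).hom x ∈ submodule Y

/-- `V` is finitely generated: there is a finite set `S` of elements of `∐ₙ Vₙ` such that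
every sub-FI-module of `V` containing `S` is all of `V`. -/
def FinitelyGenerated [Ring k] (V : FIModule.{v} k) : Prop :=
  ∃ S : Set (Σ n : ℕ, V.obj (FI.std n)), S.Finite ∧
    ∀ W : Sub V, (∀ s ∈ S, s.2 ∈ W.submodule (FI.std s.1)) → ∀ X : FI, W.submodule X = ⊤

/-- The representation of the symmetric group `Sₙ` on `Vₙ`. -/
def rep [CommRing k] (V : FIModule.{v} k) (n : ℕ) :
    Representation k (Equiv.Perm (Fin n)) (V.obj (FI.std n)) where
  toFun σ := (V.map (FI.ofPerm σ)).hom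
  map_one' := by
    change (V.map (𝟙 (FI.std n))).hom = _
    rw [V.map_id]
    rfl
  map_mul' σ τ := by
    change (V.map (FI.ofPerm τ ≫ FI.ofPerm σ)).hom = _
    rw [V.map_comp]
    rfl

end FIModule

/-- `cycleCount i σ` is `Xᵢ(σ)`, the number of `i`-cycles in the cycle decomposition of `σ`,
where fixed points count as `1`-cycles. -/
def cycleCount {n : ℕ} (i : ℕ) (σ : Equiv.Perm (Fin n)) : ℕ :=
  σ.partition.parts.count i

/-- The value at `σ` of the character polynomial `P(X₁, …, X_r)`; the variable of `P` with
index `j = 0, …, r - 1` stands for `X_{j+1}`. -/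
noncomputable def charPolyEval {n r : ℕ} (P : MvPolynomial (Fin r) ℚ)
    (σ : Equiv.Perm (Fin n)) : ℚ :=
  MvPolynomial.eval (fun j : Fin r => (cycleCount (j.val + 1) σ : ℚ)) P

/-!
Coinvariants turn the structure maps `V n → V (n + 1)` of an FI-module generated in degree `≤ d`
into surjections for `n ≥ d`, so traces of natural endomorphisms on the coinvariants are eventually
constant. Applied to `V` tensored with functions `A → X`, this says that for every permutation `τ`
of a finite set `A` the average of `χ_n(σ) * #{f | f ∘ τ = σ ∘ f}` over `σ ∈ S_n` is eventually
constant. The products `∏ j ∈ m, #Fix (σ ^ j)` are such intertwiner counts.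

A finite generating set presents `V n` as a quotient of the permutation representation on finitely
many sets of functions `Fin a → Fin n`; averaging a kernel for the trace over conjugation and
expanding it over the patterns of coincidence between `f` and `σ ∘ f` shows that, for every `n`,
`χ_n` lies in the rational span of the same finitely many products `∏ j ∈ m, #Fix (σ ^ j)`. The
Gram matrix of these products and their inner products with `χ_n` are averages as above, so positive
definiteness over `ℚ` forces `χ_n` to be eventually one fixed combination of them. Finally,
`#Fix (σ ^ j) = ∑ i ∣ j, i * X_i(σ)`.
-/

section Traces

open Filter LinearMap

variable {k : Type*} [Field k]

theorem eventuallyConst_trace_of_surjective {I : ℕ → Type*} [∀ n, AddCommGroup (I n)]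
    [∀ n, Module k (I n)] [∀ n, FiniteDimensional k (I n)] (T : ∀ n, I n →ₗ[k] I n)
    (j : ∀ n, I n →ₗ[k] I (n + 1)) (hj : ∀ᶠ n in atTop, Function.Surjective (j n))
    (hT : ∀ n, j n ∘ₗ T n = T (n + 1) ∘ₗ j n) :
    EventuallyConst (fun n => trace k (I n) (T n)) atTop := by
  obtain ⟨d, hd⟩ := eventually_atTop.1 hj
  have hanti : Antitone fun n => Module.finrank k (I (d + n)) := antitone_nat_of_succ_le fun n =>
    finrank_le_finrank_of_surjective (hd (d + n) (Nat.le_add_right _ _))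
  obtain ⟨N, hN⟩ := WellFoundedLT.antitone_chain_condition hanti
  refine eventuallyConst_atTop_nat.2 ⟨d + N, fun n hn => ?_⟩
  obtain ⟨m, rfl⟩ := Nat.exists_eq_add_of_le ((Nat.le_add_right d N).trans hn)
  have hfinrank : Module.finrank k (I (d + m)) = Module.finrank k (I (d + m + 1)) :=
    (hN m (by lia)).symm.trans (hN (m + 1) (by lia))
  have hsurj := hd (d + m) (Nat.le_add_right _ _)
  let φ := LinearEquiv.ofBijective (j (d + m))
    ⟨(injective_iff_surjective_of_finrank_eq_finrank hfinrank).2 hsurj, hsurj⟩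
  rw [← trace_conj' (T (d + m)) φ, LinearEquiv.conj_apply]
  congr 1
  exact ((LinearEquiv.comp_toLinearMap_symm_eq ..).2 (hT _)).symm

/-- The average of the representing operators is a section of the projection to coinvariants,
so the trace on coinvariants is an average of traces. -/
theorem trace_coinvariants_map {G U : Type*} [Group G] [Fintype G]
    [NeZero (Fintype.card G : k)] [AddCommGroup U] [Module k U] [FiniteDimensional k U]
    (ρ : Representation k G U) (T : ρ.IntertwiningMap ρ) :
    trace k _ (Representation.Coinvariants.map ρ ρ T) =
      (Fintype.card G : k)⁻¹ * ∑ g, trace k U (ρ g * T.toLinearMap) := by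
  let average : U →ₗ[k] U := (Fintype.card G : k)⁻¹ • ∑ g, ρ g
  let s : ρ.Coinvariants →ₗ[k] U := Representation.Coinvariants.lift ρ average fun h => by
    rw [← Module.End.mul_eq_comp, smul_mul_assoc, Finset.sum_mul]
    congr 1
    exact Fintype.sum_equiv (Equiv.mulRight h) _ _ fun g => (map_mul ρ g h).symm
  have hs : Representation.Coinvariants.mk ρ ∘ₗ s = LinearMap.id := by
    apply Representation.Coinvariants.hom_ext
    ext x
    simp [s, average, ← Nat.cast_smul_eq_nsmul k, smul_smul, NeZero.ne]
  calc trace k _ (Representation.Coinvariants.map ρ ρ T)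
      = trace k _ ((Representation.Coinvariants.mk ρ ∘ₗ T.toLinearMap) ∘ₗ s) := by
        rw [← comp_id (Representation.Coinvariants.map ρ ρ T), ← hs, ← comp_assoc]
        rfl
    _ = trace k U (average * T.toLinearMap) := by
        rw [trace_comp_comm', ← comp_assoc, Representation.Coinvariants.lift_comp_mk]
        rfl
    _ = _ := by
        rw [smul_mul_assoc, Finset.sum_mul, map_smul, map_sum, smul_eq_mul]

end Traces

theorem exists_perm_comp_eq_of_ker_eq {B X : Type*} [Finite B] {u u' : B → X}
    (h : Setoid.ker u = Setoid.ker u') : ∃ σ : Equiv.Perm X, σ ∘ u = u' := by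
  let v : Quotient (Setoid.ker u) → X := Quotient.lift u' fun a b hab => by
    rwa [← Setoid.ker_def, ← h]
  have hv : Function.Injective v := by
    rintro ⟨a⟩ ⟨b⟩ hab
    refine Quotient.sound ?_
    change Setoid.ker u a b
    rw [h]
    exact hab
  obtain ⟨σ, hσ⟩ :=
    Equiv.Perm.exists_extending_pair (Setoid.kerLift u) v (Setoid.kerLift_injective u) hv
  exact ⟨σ, funext fun a => hσ ⟦a⟧⟩

namespace FI

attribute [instance] FI.finite

instance : ConcreteCategory FI fun X Y => X.carrier ↪ Y.carrier where
  hom f := f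
  ofHom f := f

theorem exists_comp_ofPerm_eq {n : ℕ} {Y : FI} (f g : Y ⟶ std n) :
    ∃ σ : Equiv.Perm (Fin n), f ≫ ofPerm σ = g := by
  obtain ⟨σ, hσ⟩ := Equiv.Perm.exists_extending_pair (α := Y.carrier) (β := Fin n) f g
    (ConcreteCategory.hom f).injective (ConcreteCategory.hom g).injective
  exact ⟨σ, ConcreteCategory.hom_ext _ _ hσ⟩

end FI

namespace FIModule

open Filter LinearMap

variable {k : Type u} [Field k] {V : FIModule.{v} k} {d : ℕ}

theorem FinitelyGenerated.exists_span_eq_top (hV : V.FinitelyGenerated) :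
    ∃ S : Set (Σ n : ℕ, V.obj (FI.std n)), S.Finite ∧ ∀ X : FI, Submodule.span k
      (Set.range fun p : Σ s : S, FI.std s.1.1 ⟶ X => (V.map p.2).hom p.1.1.2) = ⊤ := by
  obtain ⟨S, hS, hgen⟩ := hV
  let translates (X : FI) : Set (V.obj X) :=
    Set.range fun p : Σ s : S, FI.std s.1.1 ⟶ X => (V.map p.2).hom p.1.1.2
  have map_mem {X Y : FI} (f : X ⟶ Y) :
      Submodule.span k (translates X) ≤ (Submodule.span k (translates Y)).comap (V.map f).hom := by
    rw [Submodule.span_le]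
    rintro _ ⟨⟨s, g⟩, rfl⟩
    exact Submodule.subset_span ⟨⟨s, g ≫ f⟩, by simp⟩
  refine ⟨S, hS, hgen ⟨fun X => Submodule.span k (translates X), fun f _ hx => map_mem f hx⟩
    fun s hs => Submodule.subset_span ⟨⟨⟨s, hs⟩, 𝟙 _⟩, by simp⟩⟩

theorem FinitelyGenerated.finiteDimensional (hV : V.FinitelyGenerated) (X : FI) :
    FiniteDimensional k (V.obj X) := by
  obtain ⟨S, hS, hspan⟩ := hV.exists_span_eq_top
  have := hS.to_subtype
  have (Y : FI) : Finite (Y ⟶ X) := inferInstanceAs (Finite (Y.carrier ↪ X.carrier))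
  exact ⟨hspan X ▸ Submodule.fg_span (Set.finite_range _)⟩

/-- `V` is generated in degree at most `d`: each `V(X)` is spanned by the images of the `V(Y)`
with `|Y| ≤ d`. -/
def GeneratedInDegreeLE (V : FIModule.{v} k) (d : ℕ) : Prop :=
  ∀ X : FI, Submodule.span k {z | ∃ (Y : FI) (f : Y ⟶ X) (x : V.obj Y),
    Nat.card Y.carrier ≤ d ∧ (V.map f).hom x = z} = ⊤

theorem FinitelyGenerated.exists_generatedInDegreeLE (hV : V.FinitelyGenerated) :
    ∃ d, V.GeneratedInDegreeLE d := by
  obtain ⟨S, hS, hspan⟩ := hV.exists_span_eq_top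
  obtain ⟨d, hd⟩ := (hS.image Sigma.fst).bddAbove
  refine ⟨d, fun X => top_le_iff.1 (hspan X ▸ Submodule.span_mono ?_)⟩
  rintro _ ⟨⟨s, f⟩, rfl⟩
  exact ⟨_, f, s.1.2, (Nat.card_fin s.1.1).trans_le (hd ⟨s, s.2, rfl⟩), rfl⟩

open Representation (Coinvariants)

theorem coinvariants_mk_map_eq {n : ℕ} {Y : FI} (f g : Y ⟶ FI.std n) (x : V.obj Y) :
    Coinvariants.mk (V.rep n) ((V.map f).hom x) = Coinvariants.mk (V.rep n) ((V.map g).hom x) := by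
  obtain ⟨σ, rfl⟩ := FI.exists_comp_ofPerm_eq f g
  rw [V.map_comp]
  exact (Coinvariants.mk_self_apply (V.rep n) σ ((V.map f).hom x)).symm

/-- The map `(Vₙ)_{Sₙ} → (Vₘ)_{Sₘ}` on coinvariants induced by any injection
`{1, …, n} → {1, …, m}`; the choice of the injection does not matter. -/
noncomputable def coinvariantsMap (V : FIModule.{v} k) {n m : ℕ} (i : FI.std n ⟶ FI.std m) :
    (V.rep n).Coinvariants →ₗ[k] (V.rep m).Coinvariants :=
  Coinvariants.lift (V.rep n) (Coinvariants.mk (V.rep m) ∘ₗ (V.map i).hom) fun σ => by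
    ext x
    have h := coinvariants_mk_map_eq (FI.ofPerm σ ≫ i) i x
    rwa [V.map_comp] at h

theorem GeneratedInDegreeLE.coinvariantsMap_surjective (hV : V.GeneratedInDegreeLE d) {n m : ℕ}
    (hn : d ≤ n) (i : FI.std n ⟶ FI.std m) : Function.Surjective (V.coinvariantsMap i) := by
  suffices h : ∀ y, Coinvariants.mk (V.rep m) y ∈ range (V.coinvariantsMap i) from
    fun z => (Coinvariants.mk_surjective _ z).elim fun y hy => hy ▸ h y
  suffices h : ⊤ ≤ (range (V.coinvariantsMap i)).comap (Coinvariants.mk (V.rep m)) from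
    fun y => h trivial
  rw [← hV (FI.std m), Submodule.span_le]
  rintro _ ⟨Y, f, x, hY, rfl⟩
  obtain ⟨g⟩ : Nonempty (Y.carrier ↪ Fin n) := by
    have := Fintype.ofFinite Y.carrier
    exact Function.Embedding.nonempty_of_card_le (by simpa using hY.trans hn)
  let g : Y ⟶ FI.std n := g
  refine ⟨Coinvariants.mk _ ((V.map g).hom x), ?_⟩
  rw [coinvariants_mk_map_eq f (g ≫ i), V.map_comp]
  rfl

theorem GeneratedInDegreeLE.eventuallyConst_average_trace [CharZero k]
    (hV : V.GeneratedInDegreeLE d) [∀ n, FiniteDimensional k (V.obj (FI.std n))] (T : V ⟶ V) :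
    EventuallyConst (fun n => (n.factorial : k)⁻¹ *
      ∑ σ, trace k _ (V.rep n σ * (T.app (FI.std n)).hom)) atTop := by
  let i (n : ℕ) : FI.std n ⟶ FI.std (n + 1) := Fin.castSuccEmb
  have naturality {X Y : FI} (f : X ⟶ Y) (x : V.obj X) :
      (T.app Y).hom ((V.map f).hom x) = (V.map f).hom ((T.app X).hom x) :=
    NatTrans.naturality_apply T f x
  let T' (n : ℕ) : (V.rep n).IntertwiningMap (V.rep n) :=
    ⟨(T.app (FI.std n)).hom, fun σ => LinearMap.ext (naturality (FI.ofPerm σ))⟩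
  have key := eventuallyConst_trace_of_surjective (fun n => Coinvariants.map _ _ (T' n))
    (fun n => V.coinvariantsMap (i n))
    (eventually_atTop.2 ⟨d, fun n hn => hV.coinvariantsMap_surjective hn (i n)⟩) fun n => by
      ext x
      exact congrArg (Coinvariants.mk _) (naturality (i n) x).symm
  refine key.congr (.of_eq (funext fun n => ?_))
  have : NeZero (Fintype.card (Equiv.Perm (Fin n)) : k) :=
    ⟨Nat.cast_ne_zero.2 Fintype.card_ne_zero⟩
  rw [trace_coinvariants_map, Fintype.card_perm, Fintype.card_fin]

end FIModule

section FinsuppMap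

open LinearMap

variable {k B C D M N P : Type*} [Field k] [AddCommGroup M] [Module k M] [AddCommGroup N]
  [Module k N] [AddCommGroup P] [Module k P]

/-- The tensor product `k[φ] ⊗ L : k[B] ⊗ M → k[C] ⊗ N` of the linearization of a map of sets and a
linear map, in terms of finitely supported functions. -/
noncomputable def finsuppMap (φ : B → C) (L : M →ₗ[k] N) : (B →₀ M) →ₗ[k] (C →₀ N) :=
  Finsupp.lsum k fun b => Finsupp.lsingle (φ b) ∘ₗ L

theorem finsuppMap_single (φ : B → C) (L : M →ₗ[k] N) (b : B) (x : M) :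
    finsuppMap φ L (Finsupp.single b x) = Finsupp.single (φ b) (L x) := by
  simp [finsuppMap]

theorem finsuppMap_id :
    finsuppMap id (LinearMap.id : M →ₗ[k] M) = (LinearMap.id : (B →₀ M) →ₗ[k] _) := by
  ext; simp [finsuppMap_single]

theorem finsuppMap_comp (ψ : C → D) (L' : N →ₗ[k] P) (φ : B → C) (L : M →ₗ[k] N) :
    finsuppMap ψ L' ∘ₗ finsuppMap φ L = finsuppMap (ψ ∘ φ) (L' ∘ₗ L) := by
  ext; simp [finsuppMap_single]

theorem trace_finsuppMap [Finite B] [FiniteDimensional k M] (φ : B → B) (L : M →ₗ[k] M) :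
    trace k (B →₀ M) (finsuppMap φ L) = Nat.card {b // φ b = b} * trace k M L := by
  classical
  have := Fintype.ofFinite B
  let e := Module.finBasis k M
  rw [trace_eq_matrix_trace k (Finsupp.basis fun _ : B => e), trace_eq_matrix_trace k e]
  simp only [Matrix.trace, Matrix.diag, toMatrix_apply, Fintype.sum_sigma, Finsupp.coe_basis,
    finsuppMap_single, Finsupp.basis_repr, Finsupp.single_apply]
  simp [Fintype.card_subtype, Finset.sum_ite, apply_ite, ite_apply]

end FinsuppMap

/-- The number of maps intertwining `τ` and `σ`. -/
noncomputable def intertwinerCount {A X : Type*} (τ : Equiv.Perm A) (σ : Equiv.Perm X) : ℕ :=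
  Nat.card {f : A → X // Function.Semiconj f τ σ}

namespace FIModule

open Filter LinearMap

variable {k : Type u} [Field k] {V : FIModule.{v} k} {d : ℕ} {A : Type}

/-- The FI-module `X ↦ k[X^A] ⊗ V(X)`. -/
noncomputable def funTensor (A : Type) (V : FIModule.{v} k) : FIModule.{v} k where
  obj X := ModuleCat.of k ((A → X.carrier) →₀ V.obj X)
  map f := ModuleCat.ofHom (finsuppMap (f ∘ ·) (V.map f).hom)
  map_id X := by
    rw [V.map_id, ModuleCat.hom_id]
    exact congrArg ModuleCat.ofHom finsuppMap_id
  map_comp f g := by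
    rw [V.map_comp, ModuleCat.hom_comp, ← ModuleCat.ofHom_comp, finsuppMap_comp]
    rfl

/-- The endomorphism of `k[X^A] ⊗ V(X)` given by composing functions `A → X` with `τ⁻¹`. -/
noncomputable def funTensorPrecomp (V : FIModule.{v} k) (τ : Equiv.Perm A) :
    funTensor A V ⟶ funTensor A V where
  app _ := ModuleCat.ofHom (finsuppMap (· ∘ τ.symm) LinearMap.id)
  naturality _ _ f := ModuleCat.hom_ext <| (finsuppMap_comp ..).trans
    (finsuppMap_comp (f ∘ ·) (V.map f).hom (· ∘ τ.symm) LinearMap.id).symm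

theorem GeneratedInDegreeLE.funTensor [Finite A] (hV : V.GeneratedInDegreeLE d) :
    (funTensor A V).GeneratedInDegreeLE (d + Nat.card A) := by
  intro X
  have single_mem (u : A → X.carrier) : ⊤ ≤ (Submodule.span k {z | ∃ (Y : FI) (f : Y ⟶ X)
      (x : (FIModule.funTensor A V).obj Y), Nat.card Y.carrier ≤ d + Nat.card A ∧
        ((FIModule.funTensor A V).map f).hom x = z}).comap (Finsupp.lsingle u) := by
    rw [← hV X, Submodule.span_le]
    rintro _ ⟨Y, f, x, hY, rfl⟩
    let Z : FI := ⟨↥(Set.range f ∪ Set.range u)⟩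
    let i : Z ⟶ X := Function.Embedding.subtype _
    let f' : Y ⟶ Z := (ConcreteCategory.hom f).codRestrict _ fun y => Or.inl ⟨y, rfl⟩
    let u' : A → Z.carrier := fun a => ⟨u a, Or.inr ⟨a, rfl⟩⟩
    have hZ : Nat.card Z.carrier ≤ d + Nat.card A := (Set.ncard_union_le _ _).trans
      (add_le_add ((Finite.card_range_le f).trans hY) (Finite.card_range_le u))
    refine Submodule.subset_span ⟨Z, i, Finsupp.single u' ((V.map f').hom x), hZ, ?_⟩
    rw [show f = f' ≫ i from rfl, V.map_comp]
    exact finsuppMap_single ..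
  exact Submodule.eq_top_iff'.2 fun t => Finsupp.induction_linear t (zero_mem _)
    (fun _ _ => add_mem) fun u x => single_mem u trivial

theorem GeneratedInDegreeLE.eventuallyConst_average_character_mul_intertwinerCount [CharZero k]
    [Finite A] (hV : V.GeneratedInDegreeLE d) [∀ n, FiniteDimensional k (V.obj (FI.std n))]
    (τ : Equiv.Perm A) :
    EventuallyConst (fun n : ℕ => (n.factorial : k)⁻¹ *
      ∑ σ, (V.rep n).character σ * intertwinerCount τ σ) atTop := by
  have (n : ℕ) : FiniteDimensional k ((FIModule.funTensor A V).obj (FI.std n)) :=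
    inferInstanceAs (FiniteDimensional k ((A → Fin n) →₀ V.obj (FI.std n)))
  refine (hV.funTensor.eventuallyConst_average_trace (funTensorPrecomp V τ)).congr
    (.of_eq (funext fun n => ?_))
  congr! 2 with σ
  have htrace := (congrArg (trace k _) (finsuppMap_comp (fun u : A → Fin n => σ ∘ u)
    (V.rep n σ) (· ∘ τ.symm) LinearMap.id)).trans (trace_finsuppMap ..)
  refine htrace.trans ?_
  rw [mul_comm, comp_id]
  congr! 2
  exact Nat.card_congr (Equiv.subtypeEquivRight fun f =>
    (τ.comp_symm_eq ..).trans (eq_comm.trans Function.semiconj_iff_comp_eq.symm))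

end FIModule

section Intertwiners

open Equiv Function

variable {A B X Y : Type*}

/-- The product `∏_{j ∈ m} #Fix(σ^j)`; an exponent `j = 0` contributes `|X|`. -/
noncomputable def fixProd (m : Multiset ℕ) (σ : Perm X) : ℕ :=
  (m.map fun j => Nat.card {x // (σ ^ j) x = x}).prod

theorem zpow_apply_of_semiconj {τ : Perm Y} {σ : Perm X} {f : Y → X} (hf : Semiconj f τ σ)
    (n : ℤ) (y : Y) : f ((τ ^ n) y) = (σ ^ n) (f y) := by
  have hpow (n : ℕ) (y : Y) : f ((τ ^ n) y) = (σ ^ n) (f y) := by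
    simpa only [← Perm.iterate_eq_pow] using hf.iterate_right n y
  obtain ⟨n, rfl | rfl⟩ := n.eq_nat_or_neg
  · simpa only [zpow_natCast] using hpow n y
  · rw [zpow_neg, zpow_neg, zpow_natCast, zpow_natCast, Perm.eq_inv_iff_eq, ← hpow,
      ← Perm.mul_apply, mul_inv_cancel, Perm.one_apply]

theorem zpow_apply_eq_of_zpow_apply_eq {τ : Perm Y} {σ : Perm X} {x : X} {y : Y}
    (hx : (σ ^ minimalPeriod τ y) x = x) {a b : ℤ} (hy : (τ ^ a) y = (τ ^ b) y) :
    (σ ^ a) x = (σ ^ b) x := by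
  have hperiod : τ ^ (a - b) • y = y := by
    rw [sub_eq_neg_add, zpow_add, mul_smul, zpow_neg, inv_smul_eq_iff]
    exact hy
  obtain ⟨c, hc⟩ := MulAction.zpow_smul_eq_iff_minimalPeriod_dvd.1 hperiod
  rw [← sub_add_cancel a b, add_comm, zpow_add, Perm.mul_apply, hc, zpow_mul]
  congr 1
  exact Perm.zpow_apply_eq_self_of_apply_eq_self hx c

/-- An intertwiner is determined freely by its values at one point of each orbit, subject to
being fixed by the period of the orbit. Infinite orbits have minimal period `0`. -/
theorem exists_intertwinerCount_eq_fixProd (τ : Perm Y)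
    [Finite (_root_.Quotient (Perm.SameCycle.setoid τ))] :
    ∃ m : Multiset ℕ, ∀ {X : Type} (σ : Perm X), intertwinerCount τ σ = fixProd m σ := by
  let Orbits := _root_.Quotient (Perm.SameCycle.setoid τ)
  have := Fintype.ofFinite Orbits
  let orbit (y : Y) : Orbits := ⟦y⟧
  have orbit_apply (y : Y) : orbit (τ y) = orbit y :=
    Quotient.sound (Perm.sameCycle_apply_left.2 (Perm.SameCycle.refl τ y))
  choose e he using fun y : Y => (Quotient.mk_out (s := Perm.SameCycle.setoid τ) y :
    ∃ n : ℤ, (τ ^ n) (orbit y).out = y)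
  have he_out (c : Orbits) : (τ ^ e c.out) c.out = c.out := by simpa [orbit] using he c.out
  have he_apply (y : Y) : (τ ^ e (τ y)) (orbit y).out = (τ ^ (1 + e y)) (orbit y).out := by
    rw [zpow_one_add, Perm.mul_apply, he, ← orbit_apply, he]
  refine ⟨Finset.univ.val.map fun c : Orbits => minimalPeriod τ c.out, fun {X} σ => ?_⟩
  rw [fixProd, Multiset.map_map]
  change _ = ∏ c, Nat.card _
  rw [← Nat.card_pi]
  refine Nat.card_congr ⟨fun f c => ⟨f.1 c.out, ?_⟩, fun g =>
    ⟨fun y => (σ ^ e y) (g (orbit y)).1, fun y => ?_⟩, fun f => Subtype.ext (funext fun y => ?_),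
      fun g => funext fun c => Subtype.ext ?_⟩
  · have h := zpow_apply_of_semiconj f.2 (minimalPeriod τ c.out) c.out
    rw [zpow_natCast, zpow_natCast, ← Perm.iterate_eq_pow, iterate_minimalPeriod] at h
    exact h.symm
  · change (σ ^ e (τ y)) (g (orbit (τ y))).1 = σ ((σ ^ e y) (g (orbit y)).1)
    rw [orbit_apply, zpow_apply_eq_of_zpow_apply_eq (g (orbit y)).2 (he_apply y), zpow_one_add,
      Perm.mul_apply]
  · exact (zpow_apply_of_semiconj f.2 (e y) (orbit y).out).symm.trans (congrArg f.1 (he y))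
  · change (σ ^ e c.out) (g (orbit c.out)).1 = (g c).1
    rw [show orbit c.out = c from c.out_eq]
    exact zpow_apply_eq_of_zpow_apply_eq (b := 0) (g c).2 (he_out c)

/-- The solutions `f` of a system of equations `σ^i (f a) = σ^j (f b)` are the intertwiners from
the shift on the quotient of `A × ℤ` by the shifts of the equations, which has finitely many
orbits. -/
theorem exists_card_solutions_eq_fixProd {A : Type*} [Finite A] (E : A × ℤ → A × ℤ → Prop) :
    ∃ m : Multiset ℕ, ∀ {X : Type} (σ : Perm X),
      Nat.card {f : A → X // ∀ p q, E p q → (σ ^ p.2) (f p.1) = (σ ^ q.2) (f q.1)} =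
        fixProd m σ := by
  let r (p q : A × ℤ) : Prop := ∃ n : ℤ, E (p.1, p.2 + n) (q.1, q.2 + n)
  let τ : Perm (Quot r) := Quot.congr (Equiv.prodCongrRight fun _ => Equiv.addRight 1) fun p q =>
    ⟨fun ⟨n, h⟩ => ⟨n - 1, by simpa using h⟩, fun ⟨n, h⟩ => ⟨1 + n, by simpa [add_assoc] using h⟩⟩
  have zpow_mk (a : A) (n : ℤ) : (τ ^ n) (Quot.mk r (a, 0)) = Quot.mk r (a, n) := by
    induction n with
    | zero => rfl
    | succ n ih => rw [add_comm, zpow_one_add, Perm.mul_apply, ih, add_comm]; rfl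
    | pred n ih =>
      rw [sub_eq_neg_add, zpow_add, Perm.mul_apply, ih, zpow_neg_one, Perm.inv_eq_iff_eq]
      exact congrArg (fun i => Quot.mk r (a, i)) (by simp)
  have : Finite (_root_.Quotient (Perm.SameCycle.setoid τ)) :=
    Finite.of_surjective (fun a : A => Quotient.mk _ (Quot.mk r (a, 0))) <| by
      rintro ⟨⟨a, n⟩⟩
      exact ⟨a, Quotient.sound ⟨n, zpow_mk a n⟩⟩
  obtain ⟨m, hm⟩ := exists_intertwinerCount_eq_fixProd τ
  refine ⟨m, fun {X} σ => (Nat.card_congr ?_).trans (hm σ)⟩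
  refine ⟨fun f => ⟨Quot.lift (fun p => (σ ^ p.2) (f.1 p.1)) ?_, ?_⟩,
    fun F => ⟨fun a => F.1 (Quot.mk r (a, 0)), fun p q h => ?_⟩, fun f => rfl, fun F => ?_⟩
  · rintro p q ⟨n, h⟩
    have h := f.2 _ _ h
    simp only [add_comm _ n, zpow_add, Perm.mul_apply] at h
    exact (σ ^ n).injective h
  · rintro ⟨a, n⟩
    change (σ ^ (n + 1)) (f.1 a) = σ ((σ ^ n) (f.1 a))
    rw [add_comm, zpow_one_add, Perm.mul_apply]
  · rw [← zpow_apply_of_semiconj F.2, ← zpow_apply_of_semiconj F.2, zpow_mk, zpow_mk]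
    exact congrArg F.1 (Quot.sound ⟨0, by simpa using h⟩)
  · refine Subtype.ext (funext fun y => ?_)
    obtain ⟨⟨a, n⟩, rfl⟩ := Quot.exists_rep y
    exact (zpow_apply_of_semiconj F.2 n _).symm.trans (congrArg F.1 (zpow_mk a n))

theorem intertwinerCount_sumCongr (τ : Perm A) (τ' : Perm B) (σ : Perm X) :
    intertwinerCount (τ.sumCongr τ') σ = intertwinerCount τ σ * intertwinerCount τ' σ := by
  rw [intertwinerCount, intertwinerCount, intertwinerCount, ← Nat.card_prod]
  exact Nat.card_congr (((Equiv.sumArrowEquivProdArrow A B X).subtypeEquiv fun f =>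
    Sum.forall).trans (Equiv.subtypeProdEquivProd ..))

theorem intertwinerCount_addRight_one (j : ℕ) [NeZero j] (σ : Perm X) :
    intertwinerCount (Equiv.addRight (1 : ZMod j)) σ = Nat.card {x // (σ ^ j) x = x} := by
  have iterate_apply {f : ZMod j → X} (hf : Semiconj f (Equiv.addRight 1) σ) (n : ℕ) :
      (σ ^ n) (f 0) = f n := by
    simpa [← Perm.iterate_eq_pow] using (hf.iterate_right n 0).symm
  refine Nat.card_congr ⟨fun f => ⟨f.1 0, by simpa using iterate_apply f.2 j⟩,
    fun ⟨x, hx⟩ => ⟨fun i => (σ ^ i.val) x, fun i => ?_⟩, fun f => ?_, fun x => ?_⟩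
  · have hx : IsPeriodicPt σ j x := by rwa [IsPeriodicPt, IsFixedPt, Perm.iterate_eq_pow]
    have hi : (i + 1).val = (i.val + 1) % j := by
      rw [← ZMod.val_natCast, Nat.cast_add, ZMod.natCast_zmod_val, Nat.cast_one]
    change (σ ^ (i + 1).val) x = σ ((σ ^ i.val) x)
    rw [hi, ← Perm.mul_apply, ← pow_succ', ← Perm.iterate_eq_pow, ← Perm.iterate_eq_pow,
      hx.iterate_mod_apply]
  · exact Subtype.ext (funext fun i => (iterate_apply f.2 i.val).trans (by simp))
  · exact Subtype.ext (by simp)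

theorem exists_fixProd_eq_intertwinerCount (m : Multiset ℕ) (hm : 0 ∉ m) :
    ∃ (A : Type) (_ : Finite A) (τ : Perm A),
      ∀ {X : Type} (σ : Perm X), fixProd m σ = intertwinerCount τ σ := by
  induction m using Multiset.induction with
  | empty => exact ⟨Empty, inferInstance, 1, fun σ => by simp [fixProd, intertwinerCount, Semiconj]⟩
  | cons j m ih =>
    have : NeZero j := ⟨fun h => hm (h ▸ Multiset.mem_cons_self j m)⟩
    obtain ⟨A, hA, τ, hτ⟩ := ih fun h => hm (Multiset.mem_cons_of_mem h)
    refine ⟨ZMod j ⊕ A, inferInstance, (Equiv.addRight 1).sumCongr τ, fun σ => ?_⟩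
    rw [intertwinerCount_sumCongr, intertwinerCount_addRight_one, ← hτ]
    simp only [fixProd, Multiset.map_cons, Multiset.prod_cons]

end Intertwiners

section Patterns

open Equiv

theorem sum_comp_mem_span_card_le {k G F P : Type*} [CommRing k] [Fintype F] [PartialOrder P]
    [OrderTop P] [Finite P] (K : G → F → P) (H : P → k) :
    (fun g => ∑ f, H (K g f)) ∈
      Submodule.span k (Set.range fun a g => (Nat.card {f // a ≤ K g f} : k)) := by
  classical
  have := Fintype.ofFinite P
  let := Fintype.toLocallyFiniteOrder (α := P)
  have card_eq (g : G) (a : P) : (Nat.card {f // K g f = a} : k) =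
      ∑ b ∈ Finset.Ici a, IncidenceAlgebra.mu k a b * Nat.card {f // b ≤ K g f} := by
    refine IncidenceAlgebra.moebius_inversion_top (fun b => (Nat.card {f // K g f = b} : k))
      (fun b => (Nat.card {f // b ≤ K g f} : k)) (fun b => ?_) a
    simp only [Nat.card_eq_fintype_card, Fintype.card_subtype]
    rw [Finset.card_eq_sum_card_fiberwise (f := K g) (t := Finset.Ici b) (by simp [Set.MapsTo]),
      Nat.cast_sum]
    refine Finset.sum_congr rfl fun c hc => congrArg (fun s => (Finset.card s : k)) ?_
    rw [Finset.filter_filter]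
    exact Finset.filter_congr fun f _ => and_iff_right_of_imp fun h => h ▸ Finset.mem_Ici.1 hc
  have hsum : (fun g => ∑ f, H (K g f)) = ∑ a, ∑ b ∈ Finset.Ici a,
      (H a * IncidenceAlgebra.mu k a b) • fun g => (Nat.card {f // b ≤ K g f} : k) := by
    funext g
    rw [← Fintype.sum_fiberwise' (K g) H]
    simp only [Finset.sum_apply, Pi.smul_apply, smul_eq_mul, mul_assoc, ← Finset.mul_sum, ← card_eq]
    simp [mul_comm]
  rw [hsum]
  exact Submodule.sum_mem _ fun a _ => Submodule.sum_mem _ fun b _ =>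
    Submodule.smul_mem _ _ (Submodule.subset_span ⟨b, rfl⟩)

theorem fixProd_eq_pow_mul {X : Type*} (m : Multiset ℕ) (σ : Perm X) :
    fixProd m σ = Nat.card X ^ m.count 0 * fixProd (m.filter (· ≠ 0)) σ := by
  conv_lhs => rw [fixProd, ← Multiset.filter_add_not (· = 0) m]
  simp [fixProd, Multiset.filter_eq']

theorem exists_card_le_ker_eq_fixProd {A : Type*} [Finite A] (r : Setoid (A ⊕ A)) :
    ∃ m : Multiset ℕ, ∀ {X : Type} (σ : Perm X),
      Nat.card {f : A → X // r ≤ Setoid.ker (Sum.elim f (σ ∘ f))} = fixProd m σ := by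
  let t : A ⊕ A → A × ℤ := Sum.elim (·, 0) (·, 1)
  obtain ⟨m, hm⟩ := exists_card_solutions_eq_fixProd (Relation.Map r t t)
  refine ⟨m, fun {X} σ => hm σ ▸ Nat.card_congr (Equiv.subtypeEquivRight fun f => ?_)⟩
  have ht (x : A ⊕ A) : (σ ^ (t x).2) (f (t x).1) = Sum.elim f (σ ∘ f) x := by
    rcases x with a | a <;> simp [t]
  constructor
  · rintro hf _ _ ⟨x, y, hxy, rfl, rfl⟩
    rw [ht, ht]
    exact hf hxy
  · intro hf x y hxy
    simpa only [ht] using! hf _ _ ⟨x, y, hxy, rfl, rfl⟩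

theorem exists_eq_comp_ker_sumElim {A X E : Type*} [Finite A] [Zero E]
    (h : (A → X) → (A → X) → E) (hinv : ∀ (σ : Perm X) f f', h (σ ∘ f) (σ ∘ f') = h f f') :
    ∃ H : Setoid (A ⊕ A) → E, ∀ f f', h f f' = H (Setoid.ker (Sum.elim f f')) := by
  let pattern (p : (A → X) × (A → X)) : Setoid (A ⊕ A) := Setoid.ker (Sum.elim p.1 p.2)
  have hfactor : h.uncurry.FactorsThrough pattern := by
    rintro ⟨f, f'⟩ ⟨g, g'⟩ hker
    obtain ⟨σ, hσ⟩ := exists_perm_comp_eq_of_ker_eq hker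
    rw [Sum.comp_elim, Sum.elim_eq_iff] at hσ
    obtain ⟨rfl, rfl⟩ := hσ
    exact (hinv σ f f').symm
  exact ⟨pattern.extend h.uncurry 0, fun f f' => (hfactor.extend_apply 0 (f, f')).symm⟩

theorem exists_sum_kernel_mem_span (k A : Type*) [CommRing k] [Fintype A] [DecidableEq A] :
    ∃ s : Finset (Multiset ℕ), (∀ m ∈ s, 0 ∉ m) ∧
      ∀ {X : Type} [Fintype X] (h : (A → X) → (A → X) → k),
        (∀ (σ : Perm X) f f', h (σ ∘ f) (σ ∘ f') = h f f') →
        (fun σ : Perm X => ∑ f, h f (σ ∘ f)) ∈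
          Submodule.span k ((fun m σ => (fixProd m σ : k)) '' s) := by
  classical
  have : Finite (Setoid (A ⊕ A)) :=
    Finite.of_injective (fun r => ⇑r) fun _ _ => Setoid.eq_iff_rel_eq.2
  have := Fintype.ofFinite (Setoid (A ⊕ A))
  choose m hm using exists_card_le_ker_eq_fixProd (A := A)
  refine ⟨Finset.univ.image fun r => (m r).filter (· ≠ 0), by simp, fun {X} _ h hinv => ?_⟩
  obtain ⟨H, hH⟩ := exists_eq_comp_ker_sumElim h hinv
  simp only [hH]
  refine Submodule.span_le.2 ?_
    (sum_comp_mem_span_card_le (fun (σ : Perm X) f => Setoid.ker (Sum.elim f (σ ∘ f))) H)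
  rintro _ ⟨r, rfl⟩
  simp only [hm, fixProd_eq_pow_mul (m r), Nat.cast_mul]
  exact Submodule.smul_mem _ (_ : k) (Submodule.subset_span ⟨_, by simp, rfl⟩)

end Patterns

section Rationality

open Equiv Equiv.Perm

variable {k M : Type*} [Field k] [CharZero k] [AddCommGroup M] [Module k M]
  [FiniteDimensional k M]

theorem isConj_pow_of_coprime {α : Type*} [Finite α] (σ : Perm α) {i : ℕ}
    (hi : i.Coprime (orderOf σ)) : IsConj (σ ^ i) σ := by
  classical
  have := Fintype.ofFinite α
  rw [isConj_iff_cycleType_eq]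
  induction σ using cycle_induction_on with
  | base_one => rw [one_pow]
  | base_cycles σ hσ =>
    rw [hσ.cycleType, (hσ.pow_iff.2 hi).cycleType, support_pow_coprime hi]
  | induction_disjoint σ τ hd _ hσ hτ =>
    rw [hd.orderOf] at hi
    rw [hd.commute.mul_pow, (hd.pow_disjoint_pow i i).cycleType_mul, hd.cycleType_mul,
      hσ (hi.coprime_dvd_right (Nat.dvd_lcm_left ..)),
      hτ (hi.coprime_dvd_right (Nat.dvd_lcm_right ..))]

theorem exists_sum_character_pow_eq_natCast {G : Type*} [Group G] [Finite G]
    (ρ : Representation k G M) (g : G) :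
    ∃ m : ℕ, ∑ i ∈ Finset.range (orderOf g), ρ.character (g ^ i) = m := by
  classical
  have := Fintype.ofFinite (Subgroup.zpowers g)
  let ρ' : Representation k (Subgroup.zpowers g) M := ρ.comp (Subgroup.zpowers g).subtype
  have hc : (Nat.card (Subgroup.zpowers g) : k) ≠ 0 := Nat.cast_ne_zero.2 Nat.card_pos.ne'
  let _ := invertibleOfNonzero hc
  have h := ρ'.card_inv_mul_sum_char_eq_finrank
  rw [inv_mul_eq_iff_eq_mul₀ hc, ← Nat.cast_mul] at h
  rw [← Fin.sum_univ_eq_sum_range fun i => ρ.character (g ^ i)]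
  exact ⟨_, h ▸ Fintype.sum_equiv (finEquivZPowers (isOfFinOrder_of_finite g)) _ _ fun _ => rfl⟩

/-- By strong induction on the order `o` of `σ`: the powers `σ ^ i` with `i` prime to `o` are
conjugate to `σ`, the others have smaller order, and all `o` values sum to an integer. -/
theorem character_perm_mem_fieldRange {α : Type*} [Finite α]
    (ρ : Representation k (Perm α) M) (σ : Perm α) :
    ρ.character σ ∈ (algebraMap ℚ k).fieldRange := by
  induction h : orderOf σ using Nat.strong_induction_on generalizing σ with
  | _ o ih =>
    subst h
    obtain ⟨m, hm⟩ := exists_sum_character_pow_eq_natCast ρ σ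
    rw [← Finset.sum_filter_add_sum_filter_not _ (orderOf σ).Coprime] at hm
    have sum_coprime : ∑ i ∈ Finset.range (orderOf σ) with (orderOf σ).Coprime i,
        ρ.character (σ ^ i) = (orderOf σ).totient * ρ.character σ := by
      rw [← nsmul_eq_mul, Nat.totient_eq_card_coprime]
      refine Finset.sum_eq_card_nsmul fun i hi => ?_
      obtain ⟨c, hc⟩ := isConj_iff.1 (isConj_pow_of_coprime σ (Finset.mem_filter.1 hi).2.symm)
      rw [← ρ.char_conj _ c, hc]
    have sum_not_coprime : ∑ i ∈ Finset.range (orderOf σ) with ¬ (orderOf σ).Coprime i,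
        ρ.character (σ ^ i) ∈ (algebraMap ℚ k).fieldRange := by
      refine sum_mem fun i hi => ih _ ?_ _ rfl
      rw [orderOf_pow]
      exact Nat.div_lt_self (orderOf_pos σ) (lt_of_le_of_ne'
        (Nat.gcd_pos_of_pos_left _ (orderOf_pos σ)) (Finset.mem_filter.1 hi).2)
    have totient_ne_zero : ((orderOf σ).totient : k) ≠ 0 :=
      Nat.cast_ne_zero.2 (Nat.totient_pos.2 (orderOf_pos σ)).ne'
    rw [sum_coprime, ← eq_sub_iff_add_eq, mul_comm, ← eq_div_iff totient_ne_zero] at hm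
    exact hm ▸ div_mem (sub_mem (natCast_mem _ m) sum_not_coprime) (natCast_mem _ _)

end Rationality

section Kernels

variable {k G Y M : Type*} [Field k] [Fintype Y]

theorem exists_character_eq_sum_kernel [Monoid G] [SMul G Y] [AddCommGroup M] [Module k M]
    [FiniteDimensional k M] (ρ : Representation k G M) (v : Y → M)
    (hv : Submodule.span k (Set.range v) = ⊤) (hρ : ∀ g y, ρ g (v y) = v (g • y)) :
    ∃ h : Y → Y → k, ∀ g, ρ.character g = ∑ y, h y (g • y) := by
  classical
  let π : (Y →₀ k) →ₗ[k] M := Finsupp.linearCombination k v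
  obtain ⟨s, hs⟩ := π.exists_rightInverse_of_surjective <| by
    rw [Finsupp.range_linearCombination, hv]
  refine ⟨fun y y' => s (v y') y, fun g => ?_⟩
  rw [Representation.character, ← LinearMap.comp_id (ρ g), ← hs, ← LinearMap.comp_assoc,
    LinearMap.trace_comp_comm', LinearMap.trace_eq_matrix_trace k Finsupp.basisSingleOne]
  simp [Matrix.trace, LinearMap.toMatrix_apply, π, hρ]

theorem exists_invariant_kernel_sum_eq [CharZero k] [Group G] [Finite G] [MulAction G Y]
    {χ : G → k} (hχ : ∀ a g, χ (a * g * a⁻¹) = χ g) {h : Y → Y → k}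
    (hh : ∀ g, χ g = ∑ y, h y (g • y)) :
    ∃ h' : Y → Y → k, (∀ (g : G) y y', h' (g • y) (g • y') = h' y y') ∧
      ∀ g, χ g = ∑ y, h' y (g • y) := by
  have := Fintype.ofFinite G
  refine ⟨fun y y' => (Fintype.card G : k)⁻¹ * ∑ a : G, h (a • y) (a • y'),
    fun g y y' => ?_, fun g => ?_⟩
  · simp only [smul_smul]
    exact congrArg _ (Fintype.sum_equiv (Equiv.mulRight g) _ _ fun _ => rfl)
  · have translate (a : G) : ∑ y, h (a • y) (a • g • y) = χ g := by
      rw [← hχ a g, hh]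
      exact Fintype.sum_equiv (MulAction.toPerm a) _ _ fun y => by simp [smul_smul]
    rw [← Finset.mul_sum, Finset.sum_comm]
    simp [translate]

theorem exists_rat_kernel_sum_eq [CharZero k] [SMul G Y] {χ : G → ℚ} {h : Y → Y → k}
    (hh : ∀ g, (χ g : k) = ∑ y, h y (g • y)) :
    ∃ h' : Y → Y → ℚ, ∀ g, χ g = ∑ y, h' y (g • y) := by
  obtain ⟨φ, hφ⟩ := (Algebra.linearMap ℚ k).exists_leftInverse_of_injective
    (LinearMap.ker_eq_bot.2 (algebraMap ℚ k).injective)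
  refine ⟨fun y y' => φ (h y y'), fun g => ?_⟩
  rw [← map_sum, ← hh]
  exact (LinearMap.congr_fun hφ (χ g)).symm.trans (by simp)

end Kernels

namespace FIModule

variable {k : Type u} [Field k] {V : FIModule.{v} k}

theorem FinitelyGenerated.exists_permuted_spanning_family (hV : V.FinitelyGenerated) :
    ∃ S : Set (Σ n : ℕ, V.obj (FI.std n)), S.Finite ∧
      ∀ n, ∃ v : (Σ s : S, Fin s.1.1 → Fin n) → V.obj (FI.std n),
        Submodule.span k (Set.range v) = ⊤ ∧ ∀ σ y, V.rep n σ (v y) = v (σ • y) := by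
  classical
  obtain ⟨S, hS, hspan⟩ := hV.exists_span_eq_top
  refine ⟨S, hS, fun n => ?_⟩
  let hom {m : ℕ} {f : Fin m → Fin n} (hf : f.Injective) : FI.std m ⟶ FI.std n := ⟨f, hf⟩
  refine ⟨fun y => if hf : y.2.Injective then (V.map (hom hf)).hom y.1.1.2 else 0, ?_, ?_⟩
  · rw [eq_top_iff, ← hspan]
    refine Submodule.span_mono ?_
    rintro _ ⟨⟨s, f⟩, rfl⟩
    exact ⟨⟨s, f.1⟩, dif_pos f.2⟩
  · rintro σ ⟨s, f⟩
    by_cases hf : f.Injective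
    · have hσf : (σ ∘ f).Injective := σ.injective.comp hf
      refine (congrArg _ (dif_pos hf)).trans (Eq.trans ?_ (dif_pos hσf).symm)
      exact (congrArg (fun g => g.hom s.1.2) (V.map_comp (hom hf) (FI.ofPerm σ))).symm
    · have hσf : ¬ (σ ∘ f).Injective := fun h => hf h.of_comp
      refine (congrArg _ (dif_neg hf)).trans (Eq.trans ?_ (dif_neg hσf).symm)
      exact map_zero (V.rep n σ)

theorem FinitelyGenerated.exists_rat_mem_span_fixProd [CharZero k] (hV : V.FinitelyGenerated)
    {χ : ∀ n, Equiv.Perm (Fin n) → ℚ} (hχ : ∀ n σ, (V.rep n).character σ = χ n σ) :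
    ∃ s : Finset (Multiset ℕ), (∀ m ∈ s, 0 ∉ m) ∧
      ∀ n, χ n ∈ Submodule.span ℚ ((fun m σ => (fixProd m σ : ℚ)) '' s) := by
  have := hV.finiteDimensional
  obtain ⟨S, hS, hspan⟩ := hV.exists_permuted_spanning_family
  have := hS.fintype
  choose s hs hmem using fun m : ℕ => exists_sum_kernel_mem_span ℚ (Fin m)
  refine ⟨Finset.univ.biUnion fun x : S => s x.1.1, fun m hm => ?_, fun n => ?_⟩
  · obtain ⟨x, -, hx⟩ := Finset.mem_biUnion.1 hm
    exact hs _ m hx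
  obtain ⟨v, hv, hρ⟩ := hspan n
  obtain ⟨h, hh⟩ := exists_character_eq_sum_kernel (V.rep n) v hv hρ
  obtain ⟨h, hh⟩ := exists_rat_kernel_sum_eq fun σ => (hχ n σ).symm.trans (hh σ)
  have conj_eq (τ σ : Equiv.Perm (Fin n)) : χ n (τ * σ * τ⁻¹) = χ n σ :=
    Rat.cast_injective (α := k) (by rw [← hχ, ← hχ, Representation.char_conj])
  obtain ⟨h, hinv, hh⟩ := exists_invariant_kernel_sum_eq conj_eq hh
  have hsum : χ n = ∑ x : S, fun σ : Equiv.Perm (Fin n) =>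
      ∑ f : Fin x.1.1 → Fin n, h ⟨x, f⟩ ⟨x, σ ∘ f⟩ := by
    funext σ
    rw [hh, Finset.sum_apply, Fintype.sum_sigma]
    rfl
  rw [hsum]
  refine Submodule.sum_mem _ fun x _ => Submodule.span_mono (Set.image_mono ?_)
    (hmem x.1.1 (fun f f' => h ⟨x, f⟩ ⟨x, f'⟩) fun σ f f' => hinv σ ⟨x, f⟩ ⟨x, f'⟩)
  exact Finset.coe_subset.2 <|
    Finset.subset_biUnion_of_mem (fun x : S => s x.1.1) (Finset.mem_univ x)

end FIModule

section GramMatrix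

open Filter

variable {R : Type*} [Field R] [LinearOrder R] [IsStrictOrderedRing R]

theorem eq_zero_of_mem_span_of_dotProduct_eq_zero {G : Type*} [Fintype G] {s : Set (G → R)}
    {g : G → R} (hg : g ∈ Submodule.span R s) (horth : ∀ e ∈ s, g ⬝ᵥ e = 0) : g = 0 := by
  have hle : Submodule.span R s ≤ (dotProductBilin R R g).ker := Submodule.span_le.2 horth
  exact dotProduct_self_eq_zero.1 (hle hg)

theorem eventually_forall_ge_eq_of_eventuallyConst {α β : Type*} [SemilatticeSup α] [Nonempty α]
    {f : α → β} (hf : EventuallyConst f atTop) : ∀ᶠ a in atTop, ∀ b ≥ a, f b = f a := by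
  obtain ⟨a, ha⟩ := eventuallyConst_atTop.1 hf
  filter_upwards [eventually_ge_atTop a] with b hb c hc
  rw [ha c (hb.trans hc), ha b hb]

theorem exists_mem_span_eventually_eq {G : ℕ → Type*} [∀ n, Fintype (G n)] {w : ℕ → R}
    (hw : ∀ n, w n ≠ 0) {s : Set (∀ n, G n → R)} (hs : s.Finite) {χ : ∀ n, G n → R}
    (hχ : ∀ n, χ n ∈ (Submodule.span R s).map (LinearMap.proj n))
    (hχs : ∀ E ∈ s, EventuallyConst (fun n => w n * (χ n ⬝ᵥ E n)) atTop)
    (hss : ∀ E ∈ s, ∀ E' ∈ s, EventuallyConst (fun n => w n * (E n ⬝ᵥ E' n)) atTop) :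
    ∃ F ∈ Submodule.span R s, ∀ᶠ n in atTop, χ n = F n := by
  obtain ⟨N, hχN, hsN⟩ : ∃ N, (∀ E ∈ s, ∀ n ≥ N, w n * (χ n ⬝ᵥ E n) = w N * (χ N ⬝ᵥ E N)) ∧
      ∀ E ∈ s, ∀ E' ∈ s, ∀ n ≥ N, w n * (E n ⬝ᵥ E' n) = w N * (E N ⬝ᵥ E' N) := by
    refine Eventually.exists (f := atTop) <| ((eventually_all_finite hs).2 fun E hE => ?_).and <|
      (eventually_all_finite hs).2 fun E hE => (eventually_all_finite hs).2 fun E' hE' => ?_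
    · exact eventually_forall_ge_eq_of_eventuallyConst (hχs E hE)
    · exact eventually_forall_ge_eq_of_eventuallyConst (hss E hE E' hE')
  obtain ⟨F, hF, hFN⟩ := hχ N
  have inner_eq {n : ℕ} (hn : N ≤ n) {E} (hE : E ∈ s) :
      w n * (F n ⬝ᵥ E n) = w N * (F N ⬝ᵥ E N) := by
    clear hFN
    induction hF using Submodule.span_induction with
    | mem E' hE' => exact hsN E' hE' E hE n hn
    | zero => simp
    | add F F' _ _ hF hF' => simp [mul_add, hF, hF']
    | smul a F _ hF => simp [mul_left_comm, hF]
  refine ⟨F, hF, (eventually_ge_atTop N).mono fun n hn => sub_eq_zero.1 ?_⟩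
  have hmem : χ n - F n ∈ Submodule.span R (LinearMap.proj (R := R) n '' s) := by
    rw [← LinearMap.map_span]
    exact sub_mem (hχ n) (Submodule.mem_map_of_mem hF)
  refine eq_zero_of_mem_span_of_dotProduct_eq_zero hmem ?_
  rintro _ ⟨E, hE, rfl⟩
  refine (mul_eq_zero.1 ?_).resolve_left (hw n)
  rw [sub_dotProduct, mul_sub, sub_eq_zero]
  exact (hχN E hE n hn).trans (hFN ▸ (inner_eq hn hE).symm)

end GramMatrix

namespace FIModule

open Filter

theorem generatedInDegreeLE_const {k : Type u} [Field k] (M : ModuleCat.{v} k) :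
    GeneratedInDegreeLE ((Functor.const FI).obj M) 0 := by
  refine fun X => Submodule.eq_top_iff'.2 fun z => Submodule.subset_span ?_
  exact ⟨FI.std 0, ⟨Fin.elim0, fun i => i.elim0⟩, z, by simp [FI.std], rfl⟩

variable {k : Type u} [Field k] [CharZero k] {V : FIModule.{v} k}

theorem GeneratedInDegreeLE.eventuallyConst_average_character_mul_fixProd {d : ℕ}
    (hV : V.GeneratedInDegreeLE d) [∀ n, FiniteDimensional k (V.obj (FI.std n))]
    {m : Multiset ℕ} (hm : 0 ∉ m) :
    EventuallyConst (fun n : ℕ =>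
      (n.factorial : k)⁻¹ * ∑ σ, (V.rep n).character σ * fixProd m σ) atTop := by
  obtain ⟨A, _, τ, hτ⟩ := exists_fixProd_eq_intertwinerCount m hm
  simpa only [hτ] using hV.eventuallyConst_average_character_mul_intertwinerCount τ

theorem eventuallyConst_average_fixProd_mul {m m' : Multiset ℕ} (hm : 0 ∉ m) (hm' : 0 ∉ m') :
    EventuallyConst (fun n : ℕ => (n.factorial : ℚ)⁻¹ *
      ∑ σ : Equiv.Perm (Fin n), (fixProd m σ : ℚ) * fixProd m' σ) atTop := by
  let T : FIModule.{0} ℚ := (Functor.const FI).obj (ModuleCat.of ℚ ℚ)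
  have character_eq_one (n : ℕ) (σ) : (T.rep n).character σ = 1 :=
    (LinearMap.trace_id ℚ ℚ).trans (by simp)
  have : ∀ n, FiniteDimensional ℚ (T.obj (FI.std n)) := fun _ =>
    inferInstanceAs (FiniteDimensional ℚ ℚ)
  have hT : T.GeneratedInDegreeLE 0 := generatedInDegreeLE_const _
  simpa [character_eq_one, fixProd] using
    hT.eventuallyConst_average_character_mul_fixProd (m := m + m') (by simp [hm, hm'])

theorem FinitelyGenerated.exists_eventually_character_eq (hV : V.FinitelyGenerated) :
    ∃ s : Finset (Multiset ℕ), (∀ m ∈ s, 0 ∉ m) ∧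
      ∃ F ∈ Submodule.span ℚ ((fun m n (σ : Equiv.Perm (Fin n)) => (fixProd m σ : ℚ)) '' s),
        ∀ᶠ n in atTop, ∀ σ, (V.rep n).character σ = F n σ := by
  have := hV.finiteDimensional
  obtain ⟨d, hd⟩ := hV.exists_generatedInDegreeLE
  choose χ hχ using fun n σ => character_perm_mem_fieldRange (V.rep n) σ
  replace hχ n σ : (V.rep n).character σ = χ n σ := by simp [← hχ]
  obtain ⟨s, hs, hspan⟩ := hV.exists_rat_mem_span_fixProd hχ
  have average (m) (hm : m ∈ s) : EventuallyConst (fun n : ℕ =>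
      (n.factorial : ℚ)⁻¹ * (χ n ⬝ᵥ fun σ => (fixProd m σ : ℚ))) atTop := by
    obtain ⟨N, hN⟩ := eventuallyConst_atTop.1
      (hd.eventuallyConst_average_character_mul_fixProd (hs m hm))
    simp only [hχ] at hN
    exact eventuallyConst_atTop.2 ⟨N, fun n hn => Rat.cast_injective (α := k) <| by
      simpa [dotProduct] using hN n hn⟩
  obtain ⟨F, hF, hχF⟩ := exists_mem_span_eventually_eq
    (fun n => inv_ne_zero (Nat.cast_ne_zero.2 n.factorial_ne_zero)) (s.finite_toSet.image _)
    (fun n => by simpa [Submodule.map_span, Set.image_image] using hspan n)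
    (Set.forall_mem_image.2 average)
    (Set.forall_mem_image.2 fun m hm => Set.forall_mem_image.2 fun m' hm' =>
      eventuallyConst_average_fixProd_mul (hs m hm) (hs m' hm'))
  exact ⟨s, hs, F, hF, hχF.mono fun n hn σ => by rw [hχ, hn]⟩

end FIModule

section CharacterPolynomials

open Equiv.Perm

theorem card_support_pow_eq_sum {α : Type*} [Fintype α] [DecidableEq α] (σ : Equiv.Perm α)
    (j : ℕ) : (σ ^ j).support.card = (σ.cycleType.filter (¬ · ∣ j)).sum := by
  induction σ using cycle_induction_on with
  | base_one => simp
  | base_cycles σ hσ =>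
    rw [hσ.cycleType, ← hσ.orderOf, Multiset.filter_singleton, ite_not]
    split_ifs with h
    · rw [orderOf_dvd_iff_pow_eq_one.1 h]
      simp
    · rw [hσ.support_pow_eq_iff.2 h, hσ.orderOf, Multiset.sum_singleton]
  | induction_disjoint σ τ hστ _ hσ hτ =>
    rw [hστ.commute.mul_pow, (hστ.pow_disjoint_pow j j).card_support_mul, hστ.cycleType_mul,
      Multiset.filter_add, Multiset.sum_add, hσ, hτ]

theorem card_fixed_pow_eq_sum {n j : ℕ} (σ : Equiv.Perm (Fin n)) (hj : j ≠ 0) :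
    Nat.card {x // (σ ^ j) x = x} = ∑ i ∈ j.divisors, i * cycleCount i σ := by
  have hfixed : Nat.card {x // (σ ^ j) x = x} + (σ ^ j).support.card = n := by
    rw [Nat.card_eq_fintype_card, Fintype.card_subtype]
    exact (Finset.card_filter_add_card_filter_not _).trans (Finset.card_fin n)
  have hmoved : (σ ^ j).support.card = (σ.partition.parts.filter (¬ · ∣ j)).sum := by
    have hones (c : ℕ) : (Multiset.replicate c 1).filter (¬ · ∣ j) = 0 :=
      Multiset.filter_eq_nil.2 fun i hi => by simp [Multiset.eq_of_mem_replicate hi]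
    rw [card_support_pow_eq_sum, parts_partition, Multiset.filter_add, hones, add_zero]
  have hparts : (σ.partition.parts.filter (· ∣ j)).sum +
      (σ.partition.parts.filter (¬ · ∣ j)).sum = n := by
    rw [← Multiset.sum_add, Multiset.filter_add_not, σ.partition.parts_sum, Fintype.card_fin]
  calc Nat.card {x // (σ ^ j) x = x} = (σ.partition.parts.filter (· ∣ j)).sum := by lia
    _ = ∑ i ∈ j.divisors, i * cycleCount i σ := by
      rw [Finset.sum_multiset_count_of_subset _ j.divisors fun i hi => by simp_all]
      refine Finset.sum_congr rfl fun i hi => ?_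
      rw [Multiset.count_filter_of_pos (p := (· ∣ j)) (Nat.dvd_of_mem_divisors hi), smul_eq_mul,
        mul_comm, cycleCount]

/-- Evaluation of character polynomials at all permutations of all finite degrees, as a
homomorphism of algebras. -/
noncomputable def charPolyHom (r : ℕ) :
    MvPolynomial (Fin r) ℚ →ₐ[ℚ] (∀ n, Equiv.Perm (Fin n) → ℚ) :=
  MvPolynomial.aeval fun j _ σ => (cycleCount (j.val + 1) σ : ℚ)

theorem charPolyHom_apply {r n : ℕ} (P : MvPolynomial (Fin r) ℚ) (σ : Equiv.Perm (Fin n)) :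
    charPolyHom r P n σ = charPolyEval P σ := by
  induction P using MvPolynomial.induction_on with
  | C a => simp [charPolyEval, charPolyHom, Pi.algebraMap_apply]
  | add P Q hP hQ => simp_all [charPolyEval]
  | mul_X P j hP => simp_all [charPolyEval, charPolyHom]

theorem cycleCount_mem_range_charPolyHom {r i : ℕ} (hi : i ≠ 0) (hir : i ≤ r) :
    (fun n (σ : Equiv.Perm (Fin n)) => (cycleCount i σ : ℚ)) ∈ (charPolyHom r).range := by
  obtain ⟨i, rfl⟩ := Nat.exists_eq_succ_of_ne_zero hi
  exact ⟨MvPolynomial.X ⟨i, hir⟩, MvPolynomial.aeval_X _ _⟩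

theorem fixProd_mem_range_charPolyHom {r : ℕ} {m : Multiset ℕ} (hm : 0 ∉ m)
    (hr : ∀ j ∈ m, j ≤ r) :
    (fun n (σ : Equiv.Perm (Fin n)) => (fixProd m σ : ℚ)) ∈ (charPolyHom r).range := by
  have hcard (j) (hj : j ∈ m) : (fun n (σ : Equiv.Perm (Fin n)) =>
      (Nat.card {x // (σ ^ j) x = x} : ℚ)) ∈ (charPolyHom r).range := by
    have hj0 : j ≠ 0 := fun h => hm (h ▸ hj)
    have hsum : (fun n (σ : Equiv.Perm (Fin n)) => (Nat.card {x // (σ ^ j) x = x} : ℚ)) =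
        ∑ i ∈ j.divisors, (i : ℚ) • fun n (σ : Equiv.Perm (Fin n)) => (cycleCount i σ : ℚ) := by
      funext n σ
      rw [card_fixed_pow_eq_sum σ hj0]
      simp
    rw [hsum]
    exact sum_mem fun i hi => Subalgebra.smul_mem _ (cycleCount_mem_range_charPolyHom
      (Nat.pos_of_mem_divisors hi).ne' ((Nat.divisor_le hi).trans (hr j hj))) _
  have hprod : (fun n (σ : Equiv.Perm (Fin n)) => (fixProd m σ : ℚ)) =
      (m.map fun j n (σ : Equiv.Perm (Fin n)) => (Nat.card {x // (σ ^ j) x = x} : ℚ)).prod := by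
    funext n σ
    induction m using Multiset.induction with
    | empty => simp [fixProd]
    | cons j m ih => simp_all [fixProd]
  rw [hprod]
  exact multiset_prod_mem _ (by simpa using hcard)

theorem exists_span_fixProd_le_range_charPolyHom {s : Finset (Multiset ℕ)} (hs : ∀ m ∈ s, 0 ∉ m) :
    ∃ r > 0, Submodule.span ℚ ((fun m n (σ : Equiv.Perm (Fin n)) => (fixProd m σ : ℚ)) '' s) ≤
      Subalgebra.toSubmodule (charPolyHom r).range := by
  refine ⟨s.sup Multiset.sum + 1, Nat.succ_pos _, Submodule.span_le.2 ?_⟩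
  rintro _ ⟨m, hm, rfl⟩
  refine fixProd_mem_range_charPolyHom (hs m hm) fun j hj => ?_
  exact (Multiset.le_sum_of_mem hj).trans ((Finset.le_sup hm).trans (Nat.le_succ _))

theorem exists_polynomial_charPolyEval_one_eq {r : ℕ} (P : MvPolynomial (Fin r) ℚ) :
    ∃ Q : Polynomial ℚ, ∀ n : ℕ, charPolyEval P (1 : Equiv.Perm (Fin n)) = Q.eval (n : ℚ) := by
  let Q : Polynomial ℚ := P.aeval fun j : Fin r => if j.val = 0 then Polynomial.X else 0
  refine ⟨Q, fun n => ?_⟩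
  have hQ : Q.eval (n : ℚ) = P.aeval fun j : Fin r => if j.val = 0 then (n : ℚ) else 0 := by
    rw [← Polynomial.coe_aeval_eq_eval, MvPolynomial.comp_aeval_apply]
    simp [apply_ite]
  have cycleCount_one (i : ℕ) : cycleCount i (1 : Equiv.Perm (Fin n)) = if i = 1 then n else 0 := by
    simp [cycleCount, parts_partition, Multiset.count_replicate, eq_comm]
  simp [hQ, charPolyEval, cycleCount_one, MvPolynomial.aeval_eq_eval]

end CharacterPolynomials

theorem theorem4p3 {k : Type u} [Field k] [CharZero k] (V : FIModule.{v} k)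
    (hV : V.FinitelyGenerated) :
    (∀ n : ℕ, FiniteDimensional k (V.obj (FI.std n))) ∧
    ∃ (N r : ℕ) (P : MvPolynomial (Fin r) ℚ), 0 < r ∧
      (∀ n : ℕ, N ≤ n → ∀ σ : Equiv.Perm (Fin n),
        (V.rep n).character σ = ((charPolyEval P σ : ℚ) : k)) ∧
      ∃ Q : Polynomial ℚ, ∀ n : ℕ, N ≤ n →
        (Module.finrank k (V.obj (FI.std n)) : ℚ) = Q.eval (n : ℚ) := by
  have hfin (n : ℕ) := hV.finiteDimensional (FI.std n)
  refine ⟨hfin, ?_⟩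
  obtain ⟨s, hs, F, hF, hχF⟩ := hV.exists_eventually_character_eq
  obtain ⟨N, hN⟩ := Filter.eventually_atTop.1 hχF
  obtain ⟨r, hr, hle⟩ := exists_span_fixProd_le_range_charPolyHom hs
  obtain ⟨P, rfl⟩ : ∃ P, charPolyHom r P = F := hle hF
  obtain ⟨Q, hQ⟩ := exists_polynomial_charPolyEval_one_eq P
  have character_eq (n : ℕ) (hn : N ≤ n) (σ : Equiv.Perm (Fin n)) :
      (V.rep n).character σ = ((charPolyEval P σ : ℚ) : k) := by
    rw [hN n hn σ, charPolyHom_apply]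
  refine ⟨N, r, P, hr, character_eq, Q, fun n hn => Rat.cast_injective (α := k) ?_⟩
  rw [← hQ, ← character_eq n hn, Representation.char_one, Rat.cast_natCast]
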